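/- Let $A,B$ be standard Borel spaces and let $X=(X_i)_{i\in\mathbb Z}$ be an i.i.d. $A$-valued process. For measurable $f:B^{\mathbb Z}\to\mathbb R$ put $\delta_jf=\sup\{|f(y)-f(y')|: y_\ell=y'_\ell\ \forall \ell\ne j\}\in[0,\infty]$ and $\|\delta f\|_2^2=\sum_{j\in\mathbb Z}(\delta_jf)^2$. Call $f$ local if it depends on finitely many coordinates only, and say that it has the bounded-difference property if $\delta_jf<\infty$ for all $j$. For $C\in[0,\infty]$, say that a $B$-valued process $Y=(Y_i)_{i\in\mathbb Z}$ satisfies $\mathrm{GCB}(C)$ if for every measurable local $f$ with the bounded-difference property and every $\lambda>0$ the expectations below exist and are finite, and \[ \log\mathbb E\big[\exp\{\lambda(f(Y)-\mathbb E f(Y))\}\big]\le C\,\lambda^2\,\|\delta f\|_2^2 \] (with $\infty\cdot 0=0$ on the right). 1. (Left finitary codings.) Let $\varphi:A^{\mathbb Z}\to B^{\mathbb Z}$ be measurable and commute with the shifts, and let \[ r_\varphi^-(x)=\inf\{r\in\mathbb N_0:\ \forall y\in A^{\mathbb Z},\ y_{-r}^0=x_{-r}^0\Rightarrow\varphi(y)_0=\varphi(x)_0\}\in\mathbb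 N_0\cup\{\infty\}. \] If $r_\varphi^-(X)<\infty$ almost surely and $Y=\varphi(X)$ almost surely (i.e. $Y$ is a left finitary coding of $X$), then $Y$ satisfies $\mathrm{GCB}\big(3(\mathbb E[2r_\varphi^-(X)+1])^2\big)$. 2. (Coupling from the past.) Let $f:B^{\{\dots,-2,-1\}}\times A\to B$ be measurable. For a time $m\in\mathbb Z$, a past $y=(y_l)_{l<m}$ and $x\in A^{\mathbb Z}$, let $Y^{[y,m]}(x)$ be the sequence that equals $y$ before time $m$ and satisfies $Y_j=f(Y_{-\infty}^{j-1};x_j)$ for $j\ge m$, where $Y_{-\infty}^{j-1}$ is regarded as indexed by $\{\dots,-2,-1\}$. Let \[ \theta(x)=\inf\{k\ge0:\ Y^{[y,-k]}_0(x)\text{ does not depend on }y\}\in\mathbb N_0\cup\{\infty\}, \] and let $\theta_i(x)$ be the value of $\theta$ at the shifted sequence $(x_{i+j})_{j\in\mathbb Z}$. Say that $Y$ is obtained by the CFTP algorithm from $X$ if almost surely, for every $i\in\mathbb Z$, $\theta_i(X)<\infty$ and $Y_i=Y_i^{[y,\,i-\theta_i(X)]}(X)$ for every past $y$. If $Y$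 is obtained by the CFTP algorithm from $X$ and $\mathbb E[\theta(X)]<\infty$, then $3(\mathbb E[2\theta(X)+1])^2<\infty$ and $Y$ satisfies $\mathrm{GCB}\big(3(\mathbb E[2\theta(X)+1])^2\big)$. 3. If almost surely $\theta_i(X)<\infty$ for all $i\in\mathbb Z$, and a process $Y$ satisfies $Y_i=f(Y_{-\infty}^{i-1};X_i)$ for all $i\in\mathbb Z$ almost surely, then $Y$ is obtained by the CFTP algorithm from $X$ (so part 2 applies to it). -/

import Mathlib

open MeasureTheory ProbabilityTheory
open scoped ENNReal

namespace LeftFinitary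

noncomputable section

/-- The shift `(T^j x)_i = x_{i+j}`. -/
def shift {α : Type*} (j : ℤ) (x : ℤ → α) : ℤ → α := fun i => x (i + j)

/-- `X` is an i.i.d. process indexed by `ℤ`; `X ω i` is the value of `X_i` at `ω`. -/
structure IsIID {Ω A : Type*} [MeasurableSpace Ω] [MeasurableSpace A]
    (P : Measure Ω) (X : Ω → ℤ → A) : Prop where
  measurable : ∀ i, Measurable (fun ω => X ω i)
  indep : iIndepFun (fun (i : ℤ) (ω : Ω) => X ω i) P
  identDistrib : ∀ i, IdentDistrib (fun ω => X ω i) (fun ω => X ω 0) P P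

/-! ### Local functions, oscillations, Gaussian concentration -/

/-- The oscillation `δ_j f` of `f` at the site `j`, with values in `[0, ∞]`. -/
def osc {B : Type*} (f : (ℤ → B) → ℝ) (j : ℤ) : ℝ≥0∞ :=
  ⨆ (y : ℤ → B) (y' : ℤ → B) (_ : ∀ l, l ≠ j → y l = y' l), edist (f y) (f y')

/-- The squared norm `‖δf‖₂² = ∑_j (δ_j f)²`. -/
def oscNormSq {B : Type*} (f : (ℤ → B) → ℝ) : ℝ≥0∞ := ∑' j : ℤ, osc f j ^ 2

/-- `f` depends on finitely many coordinates only. -/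
def IsLocalFun {B : Type*} (f : (ℤ → B) → ℝ) : Prop :=
  ∃ Λ : Finset ℤ, DependsOn f (Λ : Set ℤ)

/-- `log E[exp (t (f(Y) - E f(Y)))] ≤ C t² ‖δf‖₂²` for every measurable local `f` with the
bounded-difference property and every `t > 0`. The constant `C` may be `∞`; the right-hand side
is computed in `[0, ∞]`. The expectations on the left are claimed to exist. -/
def GaussianBound {Ω B : Type*} [MeasurableSpace Ω] [MeasurableSpace B]
    (P : Measure Ω) (Y : Ω → ℤ → B) (C : ℝ≥0∞) : Prop :=
  ∀ f : (ℤ → B) → ℝ, Measurable f → IsLocalFun f → (∀ j, osc f j < ∞) →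
    ∀ t : ℝ, 0 < t →
      Integrable (fun ω => f (Y ω)) P ∧
      Integrable (fun ω => Real.exp (t * (f (Y ω) - ∫ ω', f (Y ω') ∂P))) P ∧
      ((Real.log (∫ ω, Real.exp (t * (f (Y ω) - ∫ ω', f (Y ω') ∂P)) ∂P) : ℝ) : EReal) ≤
        ((C * ENNReal.ofReal (t ^ 2) * oscNormSq f : ℝ≥0∞) : EReal)

/-! ### Left finitary codings -/

/-- A coding map: measurable and commuting with the shifts. -/
structure IsCodingMap {A B : Type*} [MeasurableSpace A] [MeasurableSpace B]
    (φ : (ℤ → A) → (ℤ → B)) : Prop where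
  measurable : Measurable φ
  equivariant : ∀ (j : ℤ) (x : ℤ → A), φ (shift j x) = shift j (φ x)

/-- The left coding radius `r⁻_φ(x)` at the origin, with values in `ℕ ∪ {∞}`. -/
def leftRadius {A B : Type*} (φ : (ℤ → A) → (ℤ → B)) (x : ℤ → A) : ℕ∞ :=
  ⨅ (r : ℕ) (_ : ∀ y : ℤ → A, (∀ i : ℤ, -(r : ℤ) ≤ i → i ≤ 0 → y i = x i) → φ y 0 = φ x 0),
    (r : ℕ∞)

/-- `Y = φ(X)` almost surely, for a coding map `φ` whose left coding radius is a.s. finite. -/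
structure IsLeftFinitaryCoding {Ω A B : Type*} [MeasurableSpace Ω] [MeasurableSpace A]
    [MeasurableSpace B] (P : Measure Ω) (X : Ω → ℤ → A) (φ : (ℤ → A) → (ℤ → B))
    (Y : Ω → ℤ → B) : Prop where
  coding : IsCodingMap φ
  eq : ∀ᵐ ω ∂P, Y ω = φ (X ω)
  finite : ∀ᵐ ω ∂P, leftRadius φ (X ω) < ⊤

/-! ### Stochastic recursive sequences and coupling from the past

A past `(y_l)_{l < m}` is coded by `p : ℕ → B` with `p n = y_{m - 1 - n}`, the most recent symbol
being `p 0`. The update functions `f_i` are translates of one function `f`. -/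

/-- The past after one more symbol `b`. -/
def push {B : Type*} (p : ℕ → B) (b : B) : ℕ → B
  | 0 => b
  | n + 1 => p n

/-- The past before time `m + n` of the recursion that is started at time `m` from the past `p`
and driven by `x_m, x_{m+1}, …`. -/
def srsPast {A B : Type*} (f : (ℕ → B) → A → B) (p : ℕ → B) (m : ℤ) (x : ℤ → A) : ℕ → (ℕ → B)
  | 0 => p
  | n + 1 => push (srsPast f p m x n) (f (srsPast f p m x n) (x (m + n)))

/-- The composition `f^{[m, m+n]}`: the state at time `m + n` of the recursion started at time `m`
from the past `p` and driven by `x_m, …, x_{m+n}`. -/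
def srsState {A B : Type*} (f : (ℕ → B) → A → B) (p : ℕ → B) (m : ℤ) (x : ℤ → A) (n : ℕ) : B :=
  f (srsPast f p m x n) (x (m + n))

/-- The regeneration time `θ(x)`: the least `k` such that the state at time `0` of the recursion
started at time `-k` does not depend on the past before time `-k`. -/
def regenTime {A B : Type*} (f : (ℕ → B) → A → B) (x : ℤ → A) : ℕ∞ :=
  ⨅ (k : ℕ) (_ : ∀ p p' : ℕ → B, srsState f p (-(k : ℤ)) x k = srsState f p' (-(k : ℤ)) x k),
    (k : ℕ∞)

/-- `Y` is the output of the coupling-from-the-past algorithm with update function `f` and input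
`X`: almost surely, at every site `i` the regeneration time is finite and `Y_i` is the state at `i`
of the recursion started that many steps earlier, from whatever past. -/
def IsCFTPOutput {Ω A B : Type*} [MeasurableSpace Ω] (P : Measure Ω) (X : Ω → ℤ → A)
    (f : (ℕ → B) → A → B) (Y : Ω → ℤ → B) : Prop :=
  ∀ᵐ ω ∂P, ∀ i : ℤ, ∃ k : ℕ, regenTime f (shift i (X ω)) = (k : ℕ∞) ∧
    ∀ p : ℕ → B, Y ω i = srsState f p (i - (k : ℤ)) (X ω) k

/-- `Y` solves the recursion `Y_i = f(Y_{-∞}^{i-1}; X_i)`, `i ∈ ℤ`, almost surely. -/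
def IsRecursiveSequence {Ω A B : Type*} [MeasurableSpace Ω] (P : Measure Ω) (X : Ω → ℤ → A)
    (f : (ℕ → B) → A → B) (Y : Ω → ℤ → B) : Prop :=
  ∀ᵐ ω ∂P, ∀ i : ℤ, Y ω i = f (fun n : ℕ => Y ω (i - 1 - (n : ℤ))) (X ω i)

end

end LeftFinitary

open LeftFinitary

/-! Since the left radius is a.s. finite, `Y_j` is a function `ψ` of the i.i.d. input up to time
`j`. Hence, for `b` to the right of the sites used by `f`, `f(Y)` is a bounded functional of the
past of `X` at time `b`. Integrating out the `m` most recent symbols (`pastAverage`) gives a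
martingale read backwards in time, leading from `f(Y)` towards its mean.

Let `α_k` be the probability that the `k` most recent inputs fail to determine `ψ`. By causality,
changing the input at time `b - m` affects only sites `j ≥ b - m`, and each such `Y_j` changes with
probability at most `α_{m-(b-j)}`. So the `m`-th average oscillates in that symbol by at most `c_m =
∑_j δ_j f · α_{m-(b-j)}`, a one-sided convolution. Hoeffding's lemma at each step
(`integral_exp_le_of_oscillation`) gives the exponent `t²/2 · ∑ c_m²`, and a Young inequality
(`sum_sq_sum_mul_le`) gives `∑ c_m² ≤ (∑ α_k)² ‖δf‖₂²`. Finally `∑ α_k ≤ E[2r+1]`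
(`tsum_undetermined_le`), because non-determination by `k` symbols forces `r ≥ k`. The factor `1/2`
so obtained lies well below `3`.

A coupling-from-the-past output is a left finitary coding whose radius is at most the regeneration
time (`leftRadius_limitState_le`), so the second part reduces to the first. For the third, a
recursive sequence is reproduced by the recursion started from its own past. -/

namespace LeftFinitary

open Filter Topology

section

/-! ### Pasts and their extensions -/

/-- The past `p` followed by the symbols `z 0, …, z (k - 1)`. -/
def extendPast {A : Type*} (z p : ℕ → A) : ℕ → (ℕ → A)
  | 0 => p
  | k + 1 => push (extendPast z p k) (z k)

/-- The first symbol appended is the oldest of the new ones, so it may be counted as part of the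
initial past. This yields the one-step recursion `pastAverage_succ`. -/
theorem extendPast_push {A : Type*} (z p : ℕ → A) (a : A) (k : ℕ) :
    extendPast (push z a) p (k + 1) = extendPast z (push p a) k := by
  induction k with
  | zero => rfl
  | succ k ih =>
    have h : extendPast (push z a) p (k + 1 + 1) =
      push (extendPast (push z a) p (k + 1)) (z k) := rfl
    rw [h, ih]; rfl

theorem extendPast_of_le {A : Type*} (z p : ℕ → A) {k n : ℕ} (h : k ≤ n) :
    extendPast z p k n = p (n - k) := by
  induction k generalizing n with
  | zero => rfl
  | succ k ih =>
    obtain ⟨n, rfl⟩ : ∃ n', n = n' + 1 := ⟨n - 1, by omega⟩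
    simp only [extendPast, push]
    rw [ih (by omega)]
    congr 1
    omega

theorem extendPast_of_lt {A : Type*} (z p : ℕ → A) {k n : ℕ} (h : n < k) :
    extendPast z p k n = z (k - 1 - n) := by
  induction k generalizing n with
  | zero => omega
  | succ k ih =>
    cases n with
    | zero => rfl
    | succ n =>
      simp only [extendPast, push]
      rw [ih (by omega)]
      congr 1
      omega

theorem extendPast_add {A : Type*} (z p : ℕ → A) {l m : ℕ} (h : l ≤ m) :
    (fun n => extendPast z p m (n + l)) = extendPast z p (m - l) := by
  funext n
  rcases lt_or_ge (n + l) m with h1 | h1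
  · rw [extendPast_of_lt _ _ h1, extendPast_of_lt _ _ (by omega)]; congr 1; omega
  · rw [extendPast_of_le _ _ h1, extendPast_of_le _ _ (by omega)]; congr 1; omega

variable {A : Type*} [MeasurableSpace A]

@[fun_prop]
theorem measurable_push : Measurable (fun x : (ℕ → A) × A => push x.1 x.2) := by
  refine measurable_pi_iff.2 fun n => ?_
  cases n with
  | zero => exact measurable_snd
  | succ n => exact (measurable_pi_apply n).comp measurable_fst

@[fun_prop]
theorem measurable_extendPast (k : ℕ) :
    Measurable (fun x : (ℕ → A) × (ℕ → A) => extendPast x.1 x.2 k) := by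
  induction k with
  | zero => exact measurable_snd
  | succ k ih =>
    exact measurable_push.comp (ih.prodMk ((measurable_pi_apply k).comp measurable_fst))

/-- The law of an i.i.d. past with marginal `μ`. -/
noncomputable abbrev pastLaw (μ : Measure A) : Measure (ℕ → A) :=
  Measure.infinitePi (fun _ : ℕ => μ)

variable {μ : Measure A} [IsProbabilityMeasure μ]

theorem measurePreserving_push :
    MeasurePreserving (fun x : (ℕ → A) × A => push x.1 x.2) ((pastLaw μ).prod μ) (pastLaw μ) := by
  refine ⟨measurable_push, Measure.eq_infinitePi _ fun s t ht => ?_⟩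
  classical
  rw [Measure.map_apply measurable_push (.pi s.countable_toSet fun _ _ => ht _)]
  set s' : Finset ℕ := s.preimage Nat.succ (Nat.succ_injective.injOn) with hs'
  have h1 : (fun x : (ℕ → A) × A => push x.1 x.2) ⁻¹' ((s : Set ℕ).pi t) =
      ((s' : Set ℕ).pi fun n => t (n + 1)) ×ˢ (if 0 ∈ s then t 0 else Set.univ) := by
    ext ⟨p, a⟩
    simp only [Set.mem_preimage, Set.mem_pi, Finset.mem_coe, Set.mem_prod, hs',
      Finset.mem_preimage]
    constructor
    · intro h
      refine ⟨fun n hn => h (n + 1) hn, ?_⟩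
      split_ifs with h0
      · exact h 0 h0
      · trivial
    · rintro ⟨h, h'⟩ n hn
      cases n with
      | zero => rw [if_pos hn] at h'; exact h'
      | succ n => exact h n hn
  rw [h1, Measure.prod_prod, Measure.infinitePi_pi _ (fun i _ => ht _)]
  have h2 : ∏ n ∈ s', μ (t (n + 1)) = ∏ n ∈ s.erase 0, μ (t n) := by
    rw [hs', Finset.prod_preimage' Nat.succ s Nat.succ_injective.injOn (fun n => μ (t n))]
    refine Finset.prod_congr ?_ fun _ _ => rfl
    ext n
    cases n <;> simp
  rw [h2]
  split_ifs with h0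
  · rw [mul_comm, Finset.mul_prod_erase s (fun n => μ (t n)) h0]
  · rw [Finset.erase_eq_of_notMem h0, measure_univ, mul_one]

/-! ### Averages over the most recent symbols -/

/-- The average of `F` over the `m` most recent symbols. -/
noncomputable def pastAverage (μ : Measure A) (F : (ℕ → A) → ℝ) (m : ℕ) (q : ℕ → A) : ℝ :=
  ∫ z, F (extendPast z q m) ∂(pastLaw μ)

theorem integrable_of_bound {α : Type*} [MeasurableSpace α] {ρ : Measure α} [IsFiniteMeasure ρ]
    {F : α → ℝ} (hF : Measurable F) {M : ℝ} (hM : ∀ x, |F x| ≤ M) : Integrable F ρ :=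
  Integrable.of_bound hF.aestronglyMeasurable M (Eventually.of_forall hM)

variable {F : (ℕ → A) → ℝ} (hF : Measurable F) {M : ℝ} (hM : ∀ x, |F x| ≤ M)

include hF in
theorem measurable_pastAverage (m : ℕ) : Measurable (pastAverage μ F m) := by
  have h : StronglyMeasurable (fun x : (ℕ → A) × (ℕ → A) => F (extendPast x.2 x.1 m)) := by
    apply Measurable.stronglyMeasurable
    exact hF.comp ((measurable_extendPast m).comp measurable_swap)
  exact (h.integral_prod_right (ν := pastLaw μ)).measurable

include hM in
theorem abs_pastAverage_le (m : ℕ) (q : ℕ → A) : |pastAverage μ F m q| ≤ M := by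
  have h := norm_integral_le_of_norm_le_const (μ := pastLaw μ) (C := M)
    (f := fun z => F (extendPast z q m)) (Eventually.of_forall fun z => hM _)
  simpa [pastAverage] using h

@[simp]
theorem pastAverage_zero (q : ℕ → A) : pastAverage μ F 0 q = F q := by
  simp [pastAverage, extendPast]

theorem integral_push {G : (ℕ → A) → ℝ} (hG : Measurable G) {M : ℝ} (hM : ∀ x, |G x| ≤ M) :
    ∫ p, ∫ a, G (push p a) ∂μ ∂(pastLaw μ) = ∫ p, G p ∂(pastLaw μ) := by
  rw [← measurePreserving_push.map_eq, integral_map measurable_push.aemeasurable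
    hG.aestronglyMeasurable, integral_prod, measurePreserving_push.map_eq]
  exact integrable_of_bound (hG.comp measurable_push) fun _ => hM _

include hF hM in
theorem pastAverage_succ (m : ℕ) (p : ℕ → A) :
    pastAverage μ F (m + 1) p = ∫ a, pastAverage μ F m (push p a) ∂μ := by
  have hG : Measurable fun z : ℕ → A => F (extendPast z p (m + 1)) :=
    hF.comp ((measurable_extendPast (m + 1)).comp (measurable_id.prodMk measurable_const))
  have h := integral_push (μ := μ) hG (fun _ => hM _)
  rw [pastAverage, ← h, integral_integral_swap]
  · simp_rw [extendPast_push]; rfl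
  · exact integrable_of_bound (hG.comp measurable_push) (fun _ => hM _)

include hF hM in
theorem integral_pastAverage (m : ℕ) :
    ∫ q, pastAverage μ F m q ∂(pastLaw μ) = ∫ q, F q ∂(pastLaw μ) := by
  induction m with
  | zero => simp
  | succ m ih =>
    simp_rw [pastAverage_succ hF hM]
    rw [integral_push (measurable_pastAverage hF m) (abs_pastAverage_le hM m), ih]

/-! ### Exponential moments -/

theorem integral_exp_le_of_ae_abs_sub_le {f : A → ℝ} (hf : Measurable f) {c : ℝ}
    (h : ∀ᵐ a ∂μ, ∀ᵐ a' ∂μ, |f a - f a'| ≤ c) (t : ℝ) :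
    ∫ a, Real.exp (t * f a) ∂μ ≤
      Real.exp (t ^ 2 / 2 * c ^ 2) * Real.exp (t * ∫ a, f a ∂μ) := by
  obtain ⟨a₀, ha₀⟩ := h.exists
  -- An interval of length `2c` around one typical value suffices: it gives variance proxy `c²`
  -- instead of the sharp `c²/4`, a loss that the constant `3` absorbs.
  have hb : ∀ᵐ a ∂μ, f a ∈ Set.Icc (f a₀ - c) (f a₀ + c) := by
    filter_upwards [ha₀] with a ha
    rw [abs_le] at ha
    exact ⟨by linarith, by linarith⟩
  have h1 := (hasSubgaussianMGF_of_mem_Icc hf.aemeasurable hb).mgf_le t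
  have h2 : mgf (fun a => f a - ∫ x, f x ∂μ) μ t =
      (∫ a, Real.exp (t * f a) ∂μ) * Real.exp (-(t * ∫ a, f a ∂μ)) := by
    rw [mgf, ← integral_mul_const]
    congr 1; funext a
    rw [← Real.exp_add]; ring_nf
  have h3 : (((‖f a₀ + c - (f a₀ - c)‖₊ / 2) ^ 2 : NNReal) : ℝ) = c ^ 2 := by
    have : f a₀ + c - (f a₀ - c) = 2 * c := by ring
    rw [this]
    simp
  rw [h2, h3] at h1
  have h4 := mul_le_mul_of_nonneg_right h1 (Real.exp_pos (t * ∫ a, f a ∂μ)).le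
  rw [mul_assoc, ← Real.exp_add, neg_add_cancel, Real.exp_zero, mul_one] at h4
  refine h4.trans_eq ?_
  congr 2; ring

theorem integrable_exp_of_bound {α : Type*} [MeasurableSpace α] {ρ : Measure α}
    [IsFiniteMeasure ρ] {F : α → ℝ} (hF : Measurable F) {M : ℝ} (hM : ∀ x, |F x| ≤ M) (t : ℝ) :
    Integrable (fun x => Real.exp (t * F x)) ρ := by
  refine integrable_of_bound (M := Real.exp (|t| * M)) (by fun_prop) fun x => ?_
  rw [abs_of_pos (Real.exp_pos _)]
  refine Real.exp_le_exp.2 ((le_abs_self _).trans ?_)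
  rw [abs_mul]
  exact mul_le_mul_of_nonneg_left (hM x) (abs_nonneg _)

-- Split the past into its newest symbol and the rest, which are independent. Given the rest, the
-- mean over the newest symbol is the next average, and Hoeffding's lemma applies to that symbol
-- alone.
include hF hM in
theorem integral_exp_pastAverage_le_succ (m : ℕ) {c : ℝ}
    (h : ∀ᵐ p ∂(pastLaw μ), ∀ᵐ a ∂μ, ∀ᵐ a' ∂μ,
      |pastAverage μ F m (push p a) - pastAverage μ F m (push p a')| ≤ c) (t : ℝ) :
    ∫ q, Real.exp (t * pastAverage μ F m q) ∂(pastLaw μ) ≤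
      Real.exp (t ^ 2 / 2 * c ^ 2) *
        ∫ q, Real.exp (t * pastAverage μ F (m + 1) q) ∂(pastLaw μ) := by
  have hm := measurable_pastAverage (μ := μ) hF m
  have hI : Integrable (fun x : (ℕ → A) × A => Real.exp (t * pastAverage μ F m (push x.1 x.2)))
      ((pastLaw μ).prod μ) :=
    integrable_exp_of_bound (hm.comp measurable_push) (fun _ => abs_pastAverage_le hM m _) t
  rw [← measurePreserving_push.map_eq, integral_map measurable_push.aemeasurable
    (by fun_prop), measurePreserving_push.map_eq, integral_prod _ hI, ← integral_const_mul]
  refine integral_mono_ae hI.integral_prod_left ((integrable_exp_of_bound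
    (measurable_pastAverage hF (m + 1)) (abs_pastAverage_le hM (m + 1)) t).const_mul _) ?_
  filter_upwards [h] with p hp
  have := integral_exp_le_of_ae_abs_sub_le (μ := μ) (f := fun a => pastAverage μ F m (push p a))
    (hm.comp (measurable_push.comp (measurable_const.prodMk measurable_id))) hp t
  rwa [← pastAverage_succ hF hM] at this

-- Azuma–Hoeffding along the backward martingale. The vanishing oscillation `ε N` replaces a
-- convergence theorem: it forces the `N`-th average to within `ε N` of its mean, which is the mean
-- of `F`.
include hF hM in
theorem integral_exp_le_of_oscillation {c : ℕ → ℝ}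
    (hc : ∀ m, ∀ᵐ p ∂(pastLaw μ), ∀ᵐ a ∂μ, ∀ᵐ a' ∂μ,
      |pastAverage μ F m (push p a) - pastAverage μ F m (push p a')| ≤ c m)
    {V : ℝ} (hV : ∀ N, ∑ m ∈ Finset.range N, c m ^ 2 ≤ V) {ε : ℕ → ℝ}
    (hε : ∀ᶠ N in atTop, ∀ᵐ q ∂(pastLaw μ), ∀ᵐ q' ∂(pastLaw μ),
      |pastAverage μ F N q - pastAverage μ F N q'| ≤ ε N)
    (hε0 : Tendsto ε atTop (𝓝 0)) {t : ℝ} (ht : 0 < t) :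
    ∫ q, Real.exp (t * F q) ∂(pastLaw μ) ≤
      Real.exp (t ^ 2 / 2 * V + t * ∫ q, F q ∂(pastLaw μ)) := by
  have h1 : ∀ N, ∫ q, Real.exp (t * F q) ∂(pastLaw μ) ≤
      Real.exp (t ^ 2 / 2 * ∑ m ∈ Finset.range N, c m ^ 2) *
        ∫ q, Real.exp (t * pastAverage μ F N q) ∂(pastLaw μ) := by
    intro N
    induction N with
    | zero => simp
    | succ N ih =>
      refine ih.trans ?_
      rw [Finset.sum_range_succ, mul_add, Real.exp_add, mul_assoc]
      exact mul_le_mul_of_nonneg_left (integral_exp_pastAverage_le_succ hF hM N (hc N) t)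
        (Real.exp_pos _).le
  have h2 : ∀ᶠ N in atTop, ∫ q, Real.exp (t * F q) ∂(pastLaw μ) ≤
      Real.exp (t ^ 2 / 2 * V + t * (∫ q, F q ∂(pastLaw μ) + ε N)) := by
    filter_upwards [hε] with N hN
    refine (h1 N).trans ?_
    rw [Real.exp_add]
    refine mul_le_mul (Real.exp_le_exp.2 (mul_le_mul_of_nonneg_left (hV N) (by positivity))) ?_
      (integral_nonneg fun _ => (Real.exp_pos _).le) (Real.exp_pos _).le
    have hi := integrable_of_bound (ρ := pastLaw μ) (measurable_pastAverage (μ := μ) hF N)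
      (abs_pastAverage_le hM N)
    have h3 : ∀ᵐ q ∂(pastLaw μ), Real.exp (t * pastAverage μ F N q) ≤
        Real.exp (t * (∫ q, F q ∂(pastLaw μ) + ε N)) := by
      filter_upwards [hN] with q hq
      refine Real.exp_le_exp.2 (mul_le_mul_of_nonneg_left ?_ ht.le)
      have h4 : ∫ _, (pastAverage μ F N q - ε N) ∂(pastLaw μ) ≤
          ∫ q', pastAverage μ F N q' ∂(pastLaw μ) := by
        refine integral_mono_ae (integrable_const _) hi ?_
        filter_upwards [hq] with q' hq'
        have := (abs_le.1 hq').2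
        linarith
      rw [integral_pastAverage hF hM] at h4
      simp at h4
      linarith
    have h5 := integral_mono_ae (integrable_exp_of_bound (ρ := pastLaw μ)
      (measurable_pastAverage (μ := μ) hF N) (abs_pastAverage_le hM N) t) (integrable_const _) h3
    simpa using h5
  refine ge_of_tendsto ?_ h2
  refine (Real.continuous_exp.tendsto _).comp ?_
  have := ((hε0.const_add (∫ q, F q ∂(pastLaw μ))).const_mul t).const_add (t ^ 2 / 2 * V)
  simpa using this

end

section

/-! ### Oscillations -/

theorem abs_sub_le_osc {B : Type*} {f : (ℤ → B) → ℝ} {j : ℤ} (hj : osc f j < ∞) {y y' : ℤ → B}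
    (h : ∀ l, l ≠ j → y l = y' l) : |f y - f y'| ≤ (osc f j).toReal := by
  have h1 : edist (f y) (f y') ≤ osc f j :=
    le_iSup_of_le y (le_iSup_of_le y' (le_iSup_of_le h le_rfl))
  have h2 := ENNReal.toReal_mono hj.ne h1
  rwa [← dist_edist, Real.dist_eq] at h2

open Classical in
theorem abs_sub_le_sum_osc_of_eq_off {B : Type*} {f : (ℤ → B) → ℝ} (hf : ∀ j, osc f j < ∞)
    (s : Finset ℤ) (y y' : ℤ → B) (h : ∀ j ∉ s, y j = y' j) :
    |f y - f y'| ≤ ∑ j ∈ s, (osc f j).toReal * (if y j = y' j then 0 else 1) := by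
  induction s using Finset.induction_on generalizing y with
  | empty =>
    have : y = y' := funext fun j => h j (by simp)
    simp [this]
  | insert j s hj ih =>
    rw [Finset.sum_insert hj]
    have h1 := ih (Function.update y j (y' j)) (by
      intro i hi
      by_cases hij : i = j
      · subst hij; simp
      · rw [Function.update_of_ne hij]; exact h i (by simp [hij, hi]))
    have h2 : ∑ i ∈ s, (osc f i).toReal * (if Function.update y j (y' j) i = y' i then 0 else 1) =
        ∑ i ∈ s, (osc f i).toReal * (if y i = y' i then (0 : ℝ) else 1) := by
      refine Finset.sum_congr rfl fun i hi => ?_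
      rw [Function.update_of_ne (by rintro rfl; exact hj hi)]
    have h3 : |f y - f (Function.update y j (y' j))| ≤
        (osc f j).toReal * (if y j = y' j then 0 else 1) := by
      split_ifs with he
      · rw [← he, Function.update_eq_self]; simp
      · rw [mul_one]
        exact abs_sub_le_osc (hf j) fun l hl => (Function.update_of_ne hl _ _).symm
    rw [h2] at h1
    exact (abs_sub_le _ _ _).trans (add_le_add h3 h1)

open Classical in
theorem abs_sub_le_sum_osc {B : Type*} {f : (ℤ → B) → ℝ} (hf : ∀ j, osc f j < ∞)
    {s : Finset ℤ} (hs : DependsOn f (s : Set ℤ)) (y y' : ℤ → B) :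
    |f y - f y'| ≤ ∑ j ∈ s, (osc f j).toReal * (if y j = y' j then 0 else 1) := by
  -- A hybrid sequence differs from `y` only on `s`, so finitely many single-site changes suffice.
  have h1 : f y' = f (fun j => if j ∈ s then y' j else y j) :=
    hs fun j hj => by simp [Finset.mem_coe.1 hj]
  rw [h1]
  refine (abs_sub_le_sum_osc_of_eq_off hf s _ _ (by intro j hj; simp [hj])).trans_eq ?_
  exact Finset.sum_congr rfl fun j hj => by simp [hj]

theorem exists_bound_of_osc_lt_top {B : Type*} {f : (ℤ → B) → ℝ} (hf : ∀ j, osc f j < ∞)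
    {s : Finset ℤ} (hs : DependsOn f (s : Set ℤ)) : ∃ M, ∀ y, |f y| ≤ M := by
  classical
  rcases isEmpty_or_nonempty (ℤ → B) with he | ⟨⟨y₀⟩⟩
  · exact ⟨0, fun y => he.elim y⟩
  refine ⟨|f y₀| + ∑ j ∈ s, (osc f j).toReal, fun y => ?_⟩
  have h1 := abs_sub_le_sum_osc hf hs y y₀
  have h2 : ∑ j ∈ s, (osc f j).toReal * (if y j = y₀ j then 0 else 1) ≤
      ∑ j ∈ s, (osc f j).toReal := by
    refine Finset.sum_le_sum fun j _ => ?_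
    split_ifs <;> simp
  have h3 := abs_sub_abs_le_abs_sub (f y) (f y₀)
  linarith

/-! ### A convolution inequality -/

/-- Schur test for the matrix `α (m - l j)`: injectivity of `l` bounds the row sums by `∑ α`, the
column sums obey the same bound, and Cauchy–Schwarz combines the two. -/
theorem sum_sq_sum_mul_le {ι : Type*} (s : Finset ι) (l : ι → ℕ) (hl : Set.InjOn l s) (δ : ι → ℝ)
    {α : ℕ → ℝ} (hα0 : ∀ k, 0 ≤ α k) (hα : Summable α) (N : ℕ) :
    ∑ m ∈ Finset.range N, (∑ j ∈ s, δ j * (if l j ≤ m then α (m - l j) else 0)) ^ 2 ≤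
      (∑' k, α k) ^ 2 * ∑ j ∈ s, δ j ^ 2 := by
  set a : ℕ → ι → ℝ := fun m j => if l j ≤ m then α (m - l j) else 0 with ha
  have ha0 : ∀ m j, 0 ≤ a m j := by
    intro m j; simp only [ha]; split_ifs
    · exact hα0 _
    · exact le_rfl
  set S := ∑' k, α k with hS
  have hS0 : 0 ≤ S := tsum_nonneg hα0
  have hrow : ∀ m, ∑ j ∈ s, a m j ≤ S := by
    intro m
    simp only [ha]
    rw [← Finset.sum_filter]
    have hinj : Set.InjOn (fun j => m - l j) (s.filter fun j => l j ≤ m) := by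
      intro i hi j hj hij
      simp only [Finset.coe_filter, Set.mem_ofPred_eq] at hi hj hij
      exact hl hi.1 hj.1 (by omega)
    rw [← Finset.sum_image hinj (f := α)]
    exact hα.sum_le_tsum _ fun k _ => hα0 k
  have hcol : ∀ j, ∑ m ∈ Finset.range N, a m j ≤ S := by
    intro j
    simp only [ha]
    rw [← Finset.sum_filter]
    have hinj : Set.InjOn (fun m => m - l j) ((Finset.range N).filter fun m => l j ≤ m) := by
      intro i hi j' hj hij
      simp only [Finset.coe_filter, Set.mem_ofPred_eq] at hi hj hij
      omega
    rw [← Finset.sum_image hinj (f := α)]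
    exact hα.sum_le_tsum _ fun k _ => hα0 k
  have hcs : ∀ m, (∑ j ∈ s, δ j * a m j) ^ 2 ≤ S * ∑ j ∈ s, δ j ^ 2 * a m j := by
    intro m
    refine (Finset.sum_sq_le_sum_mul_sum_of_sq_le_mul s (r := fun j => δ j * a m j)
      (f := fun j => a m j) (g := fun j => δ j ^ 2 * a m j) (fun j _ => ha0 m j)
      (fun j _ => mul_nonneg (sq_nonneg _) (ha0 m j)) (fun j _ => le_of_eq (by ring))).trans ?_
    exact mul_le_mul_of_nonneg_right (hrow m)
      (Finset.sum_nonneg fun j _ => mul_nonneg (sq_nonneg _) (ha0 m j))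
  calc ∑ m ∈ Finset.range N, (∑ j ∈ s, δ j * a m j) ^ 2
      ≤ ∑ m ∈ Finset.range N, S * ∑ j ∈ s, δ j ^ 2 * a m j := Finset.sum_le_sum fun m _ => hcs m
    _ = S * ∑ j ∈ s, δ j ^ 2 * ∑ m ∈ Finset.range N, a m j := by
        rw [← Finset.mul_sum, Finset.sum_comm]
        simp_rw [Finset.mul_sum]
    _ ≤ S * ∑ j ∈ s, δ j ^ 2 * S := by
        refine mul_le_mul_of_nonneg_left (Finset.sum_le_sum fun j _ => ?_) hS0
        exact mul_le_mul_of_nonneg_left (hcol j) (sq_nonneg _)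
    _ = S ^ 2 * ∑ j ∈ s, δ j ^ 2 := by rw [← Finset.sum_mul]; ring

/-! ### Sets where the recent symbols leave a functional of the past undetermined -/

variable {A B : Type*} [MeasurableSpace A]

/-- The symbols `z 0, …, z (k - 1)` do not determine the value of `ψ`, up to null sets. -/
def undetermined (μ : Measure A) (ψ : (ℕ → A) → B) (k : ℕ) : Set (ℕ → A) :=
  {z | ((pastLaw μ).prod (pastLaw μ))
    {x | ψ (extendPast z x.1 k) ≠ ψ (extendPast z x.2 k)} ≠ 0}

variable {μ : Measure A} [IsProbabilityMeasure μ] [MeasurableSpace B] [MeasurableEq B]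
  {ψ : (ℕ → A) → B} (hψ : Measurable ψ)

-- Testing determination on two independent pasts, rather than on all pasts, is what makes this set
-- measurable, by Fubini.
include hψ in
theorem measurableSet_undetermined (k : ℕ) : MeasurableSet (undetermined μ ψ k) := by
  have hs : MeasurableSet {x : (ℕ → A) × ((ℕ → A) × (ℕ → A)) |
      ψ (extendPast x.1 x.2.1 k) ≠ ψ (extendPast x.1 x.2.2 k)} := by
    refine (measurableSet_eq_fun ?_ ?_).compl
    · exact hψ.comp ((measurable_extendPast k).comp
        (measurable_fst.prodMk (measurable_fst.comp measurable_snd)))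
    · exact hψ.comp ((measurable_extendPast k).comp
        (measurable_fst.prodMk (measurable_snd.comp measurable_snd)))
  have h := measurable_measure_prodMk_left (ν := (pastLaw μ).prod (pastLaw μ)) hs
  exact (measurableSet_eq_fun h measurable_const).compl

omit [MeasurableSpace B] [MeasurableEq B] in
theorem exists_ae_eq_of_notMem_undetermined {k : ℕ} {z : ℕ → A} (hz : z ∉ undetermined μ ψ k) :
    ∃ c, ∀ᵐ q ∂(pastLaw μ), ψ (extendPast z q k) = c := by
  have h : ∀ᵐ x ∂((pastLaw μ).prod (pastLaw μ)),
      ψ (extendPast z x.1 k) = ψ (extendPast z x.2 k) := by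
    simpa [undetermined, ae_iff] using hz
  obtain ⟨q, hq⟩ := (Measure.ae_ae_of_ae_prod h).exists
  exact ⟨ψ (extendPast z q k), hq.mono fun _ h => h.symm⟩

-- Only the marginal laws of `g` and `g'` matter, not their coupling: for `z` outside the
-- undetermined set both values equal the same constant almost surely. This covers both two pasts
-- sharing all but one symbol and two independent pasts.
include hψ in
theorem ae_measure_ne_le_undetermined {α : Type*} [MeasurableSpace α] {ρ : Measure α} [SFinite ρ]
    {g g' : α → ℕ → A} (hg : MeasurePreserving g ρ (pastLaw μ))
    (hg' : MeasurePreserving g' ρ (pastLaw μ)) (k : ℕ) :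
    ∀ᵐ x ∂ρ, pastLaw μ {z | ψ (extendPast z (g x) k) ≠ ψ (extendPast z (g' x) k)} ≤
      pastLaw μ (undetermined μ ψ k) := by
  have h1 : ∀ z, ∀ᵐ x ∂ρ,
      z ∈ undetermined μ ψ k ∨ ψ (extendPast z (g x) k) = ψ (extendPast z (g' x) k) := by
    intro z
    by_cases hz : z ∈ undetermined μ ψ k
    · simp [hz]
    obtain ⟨c, hc⟩ := exists_ae_eq_of_notMem_undetermined hz
    filter_upwards [hg.quasiMeasurePreserving.ae hc, hg'.quasiMeasurePreserving.ae hc] with x h h'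
    exact Or.inr (h.trans h'.symm)
  have hm : MeasurableSet {x : (ℕ → A) × α | x.1 ∈ undetermined μ ψ k ∨
      ψ (extendPast x.1 (g x.2) k) = ψ (extendPast x.1 (g' x.2) k)} := by
    refine (measurable_fst (measurableSet_undetermined hψ k)).union (measurableSet_eq_fun ?_ ?_)
    · exact hψ.comp ((measurable_extendPast k).comp
        (measurable_fst.prodMk (hg.measurable.comp measurable_snd)))
    · exact hψ.comp ((measurable_extendPast k).comp
        (measurable_fst.prodMk (hg'.measurable.comp measurable_snd)))
  have h2 := (Measure.ae_ae_comm (μ := pastLaw μ) (ν := ρ) hm).1 (Eventually.of_forall h1)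
  filter_upwards [h2] with x hx
  refine measure_mono_ae ?_
  filter_upwards [hx] with z hz hne
  exact hz.resolve_right hne

/-! ### Concentration for functionals of the i.i.d. past -/

/-- The functional of the past `x` obtained by applying `f` to the sequence whose value at `j` is
`ψ` of the past before time `j + 1`, where `x` is the past before time `b + 1`. -/
def pastFunctional (f : (ℤ → B) → ℝ) (ψ : (ℕ → A) → B) (b : ℤ) (x : ℕ → A) : ℝ :=
  f fun j => ψ fun n => x (n + (b - j).toNat)

omit [MeasurableEq B] in
include hψ in
theorem measurable_pastFunctional {f : (ℤ → B) → ℝ} (hf : Measurable f) (b : ℤ) :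
    Measurable (pastFunctional f ψ b) := by
  refine hf.comp (measurable_pi_iff.2 fun j => hψ.comp (measurable_pi_iff.2 fun n => ?_))
  exact measurable_pi_apply _

include hψ in
theorem abs_pastAverage_sub_le {f : (ℤ → B) → ℝ} (hfm : Measurable f) (hf : ∀ j, osc f j < ∞)
    {s : Finset ℤ} (hs : DependsOn f (s : Set ℤ)) (b : ℤ) (m : ℕ) (q q' : ℕ → A) :
    |pastAverage μ (pastFunctional f ψ b) m q - pastAverage μ (pastFunctional f ψ b) m q'| ≤
      ∑ j ∈ s, (osc f j).toReal * (pastLaw μ {z |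
        ψ (fun n => extendPast z q m (n + (b - j).toNat)) ≠
          ψ (fun n => extendPast z q' m (n + (b - j).toNat))}).toReal := by
  classical
  obtain ⟨M, hM⟩ := exists_bound_of_osc_lt_top hf hs
  have he : ∀ q : ℕ → A, Measurable fun z : ℕ → A => extendPast z q m := fun q =>
    (measurable_extendPast m).comp (measurable_id.prodMk measurable_const)
  have hψ' : ∀ (q : ℕ → A) (j : ℤ),
      Measurable fun z : ℕ → A => ψ (fun n => extendPast z q m (n + (b - j).toNat)) :=
    fun q j => hψ.comp (measurable_pi_iff.2 fun n => (measurable_pi_apply _).comp (he q))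
  have hi : ∀ q, Integrable (fun z => pastFunctional f ψ b (extendPast z q m)) (pastLaw μ) :=
    fun q => integrable_of_bound ((measurable_pastFunctional hψ hfm b).comp (he q)) fun _ => hM _
  have hne : ∀ j, MeasurableSet {z | ψ (fun n => extendPast z q m (n + (b - j).toNat)) ≠
          ψ (fun n => extendPast z q' m (n + (b - j).toNat))} := fun j =>
    (measurableSet_eq_fun (hψ' q j) (hψ' q' j)).compl
  rw [pastAverage, pastAverage, ← integral_sub (hi q) (hi q')]
  refine (abs_integral_le_integral_abs).trans ?_
  have h1 : ∀ j ∈ s, Integrable (fun z => (osc f j).toReal *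
      ({z | ψ (fun n => extendPast z q m (n + (b - j).toNat)) ≠
        ψ (fun n => extendPast z q' m (n + (b - j).toNat))}.indicator (fun _ => (1 : ℝ)) z))
      (pastLaw μ) := fun j _ => ((integrable_const _).indicator (hne j)).const_mul _
  have h2 := integral_mono (μ := pastLaw μ) ((hi q).sub (hi q')).abs (integrable_finsetSum s h1)
    (fun z => by
      refine (abs_sub_le_sum_osc hf hs _ _).trans_eq (Finset.sum_congr rfl fun j _ => ?_)
      simp only [Set.indicator_apply, Set.mem_ofPred_eq]
      congr 1
      split_ifs <;> simp_all)
  refine h2.trans_eq ?_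
  rw [integral_finsetSum s h1]
  refine Finset.sum_congr rfl fun j _ => ?_
  rw [integral_const_mul, integral_indicator_const _ (hne j)]
  simp [Measure.real]

include hψ in
theorem integral_exp_pastFunctional_le {f : (ℤ → B) → ℝ} (hfm : Measurable f)
    (hf : ∀ j, osc f j < ∞) {s : Finset ℤ} (hs : DependsOn f (s : Set ℤ)) {b : ℤ}
    (hb : ∀ j ∈ s, j ≤ b) (hα : ∑' k, pastLaw μ (undetermined μ ψ k) ≠ ∞) {t : ℝ} (ht : 0 < t) :
    ∫ q, Real.exp (t * pastFunctional f ψ b q) ∂(pastLaw μ) ≤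
      Real.exp (t ^ 2 / 2 * ((∑' k, pastLaw μ (undetermined μ ψ k)).toReal ^ 2 *
        ∑ j ∈ s, (osc f j).toReal ^ 2) + t * ∫ q, pastFunctional f ψ b q ∂(pastLaw μ)) := by
  obtain ⟨M, hM⟩ := exists_bound_of_osc_lt_top hf hs
  set l : ℤ → ℕ := fun j => (b - j).toNat with hl
  set α : ℕ → ℝ := fun k => (pastLaw μ (undetermined μ ψ k)).toReal with hαd
  have hα0 : ∀ k, 0 ≤ α k := fun k => ENNReal.toReal_nonneg
  have hαs : Summable α := ENNReal.summable_toReal hα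
  have hαt : (∑' k, pastLaw μ (undetermined μ ψ k)).toReal = ∑' k, α k :=
    ENNReal.tsum_toReal_eq fun k => measure_ne_top _ _
  have hmp1 : MeasurePreserving (fun x : ((ℕ → A) × A) × A => push x.1.1 x.1.2)
      (((pastLaw μ).prod μ).prod μ) (pastLaw μ) :=
    measurePreserving_push.comp measurePreserving_fst
  have hmp2 : MeasurePreserving (fun x : ((ℕ → A) × A) × A => push x.1.1 x.2)
      (((pastLaw μ).prod μ).prod μ) (pastLaw μ) :=
    measurePreserving_push.comp (measurePreserving_fst.prod (MeasurePreserving.id μ))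
  -- A site with `l j ≤ m` sees `m - l j` fresh symbols before it reaches `q` or `q'`. A site with
  -- `l j > m` sees no fresh symbol and contributes nothing if the tails it reads agree.
  have key : ∀ (m : ℕ) (q q' : ℕ → A), (∀ k, pastLaw μ
      {z | ψ (extendPast z q k) ≠ ψ (extendPast z q' k)} ≤ pastLaw μ (undetermined μ ψ k)) →
      (∀ j ∈ s, m < l j → (fun n => q (n + l j - m)) = fun n => q' (n + l j - m)) →
      |pastAverage μ (pastFunctional f ψ b) m q - pastAverage μ (pastFunctional f ψ b) m q'| ≤
        ∑ j ∈ s, (osc f j).toReal * (if l j ≤ m then α (m - l j) else 0) := by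
    intro m q q' hq hj
    refine (abs_pastAverage_sub_le hψ hfm hf hs b m q q').trans (Finset.sum_le_sum fun j hjs => ?_)
    refine mul_le_mul_of_nonneg_left ?_ ENNReal.toReal_nonneg
    change (pastLaw μ {z | ψ (fun n => extendPast z q m (n + l j)) ≠
          ψ (fun n => extendPast z q' m (n + l j))}).toReal ≤ _
    split_ifs with hlm
    · simp_rw [extendPast_add _ _ hlm]
      exact ENNReal.toReal_mono (measure_ne_top _ _) (hq _)
    · have h1 : ∀ z q : ℕ → A, (fun n => extendPast z q m (n + l j)) = fun n => q (n + l j - m) :=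
        fun z q => funext fun n => extendPast_of_le _ _ (by omega)
      simp_rw [h1, hj j hjs (by omega)]
      simp
  rw [hαt]
  refine integral_exp_le_of_oscillation (μ := μ) (measurable_pastFunctional hψ hfm b)
    (fun _ => hM _)
    (c := fun m => ∑ j ∈ s, (osc f j).toReal * (if l j ≤ m then α (m - l j) else 0)) ?_
    (sum_sq_sum_mul_le s l ?_ _ hα0 hαs)
    (ε := fun m => ∑ j ∈ s, (osc f j).toReal * (if l j ≤ m then α (m - l j) else 0)) ?_ ?_ ht
  · intro m
    have h1 := ae_all_iff.2 fun k => ae_measure_ne_le_undetermined hψ hmp1 hmp2 k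
    filter_upwards [Measure.ae_ae_of_ae_prod (Measure.ae_ae_of_ae_prod h1)] with p hp
    filter_upwards [hp] with a ha
    filter_upwards [ha] with a' ha'
    -- When `l j > m`, the site reads only positions at least `1`, beyond the single symbol in which
    -- the two pasts differ.
    refine key m _ _ ha' fun j _ hj => funext fun n => ?_
    obtain ⟨i, hi⟩ : ∃ i, n + l j - m = i + 1 := ⟨n + l j - m - 1, by omega⟩
    rw [hi]; rfl
  · intro i hi j hj hij
    have := hb i hi
    have := hb j hj
    simp only [hl] at hij
    omega
  -- From here on no site of `s` has `l j > N`, so the two pasts may be entirely independent.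
  · filter_upwards [eventually_ge_atTop (s.sup l)] with N hN
    have h1 := ae_all_iff.2 fun k => ae_measure_ne_le_undetermined (μ := μ) hψ
      (measurePreserving_fst (μ := pastLaw μ) (ν := pastLaw μ))
      (measurePreserving_snd (μ := pastLaw μ) (ν := pastLaw μ)) k
    filter_upwards [Measure.ae_ae_of_ae_prod h1] with q hq
    filter_upwards [hq] with q' hq'
    refine key N _ _ hq' fun j hj hlt => ?_
    have := Finset.le_sup (f := l) hj
    omega
  · rw [show (0 : ℝ) = ∑ j ∈ s, (osc f j).toReal * 0 by simp]
    refine tendsto_finsetSum _ fun j _ => Tendsto.const_mul _ ?_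
    have h1 : Tendsto (fun N => α (N - l j)) atTop (𝓝 0) :=
      hαs.tendsto_atTop_zero.comp (tendsto_sub_atTop_nat _)
    refine h1.congr' ?_
    filter_upwards [eventually_ge_atTop (l j)] with N hN
    rw [if_pos hN]

end

section

/-! ### Left finitary codings -/

theorem exists_lt_of_iInf_natCast_lt {p : ℕ → Prop} {n : ℕ∞}
    (h : (⨅ (r : ℕ) (_ : p r), (r : ℕ∞)) < n) : ∃ r : ℕ, (r : ℕ∞) < n ∧ p r := by
  simp only [iInf_lt_iff] at h
  obtain ⟨r, hr, hlt⟩ := h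
  exact ⟨r, hlt, hr⟩

/-- The sequence with past and present `p` and constant future `a`. -/
def extendFuture {A : Type*} (a : A) (p : ℕ → A) : ℤ → A :=
  fun i => if i ≤ 0 then p (-i).toNat else a

/-- For finite `r` the sum is exactly `r + 1`. -/
theorem tsum_indicator_natCast_le (r : ℕ∞) :
    ∑' k : ℕ, (if (k : ℕ∞) ≤ r then (1 : ℝ≥0∞) else 0) ≤ 2 * (r : ℝ≥0∞) + 1 := by
  induction r using ENat.recTopCoe with
  | top => simp
  | coe n =>
    rw [tsum_eq_sum (s := Finset.range (n + 1))]
    · refine (Finset.sum_le_card_nsmul _ _ 1 fun k _ => ?_).trans ?_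
      · split_ifs <;> simp
      · simp only [Finset.card_range, nsmul_eq_mul, mul_one, ENat.toENNReal_coe]
        norm_cast
        omega
    · intro k hk
      rw [if_neg]
      simpa using hk

variable {Ω A B : Type*} [MeasurableSpace Ω] [MeasurableSpace A] [MeasurableSpace B]
  {P : Measure Ω} {X : Ω → ℤ → A} {φ : (ℤ → A) → (ℤ → B)}

theorem measurable_extendFuture (a : A) : Measurable (extendFuture a) := by
  refine measurable_pi_iff.2 fun i => ?_
  unfold extendFuture
  split_ifs
  · exact measurable_pi_apply _
  · exact measurable_const

theorem IsIID.map_comp_eq [IsProbabilityMeasure P] (hX : IsIID P X) {ι : Type*} {e : ι → ℤ}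
    (he : Function.Injective e) :
    P.map (fun ω i => X ω (e i)) = Measure.infinitePi fun _ : ι => P.map fun ω => X ω 0 := by
  have h := iIndepFun.map_fun_eq_infinitePi_map₀
    (measurable_pi_iff.2 fun i => hX.measurable (e i)).aemeasurable (hX.indep.precomp he)
  rw [h]
  congr 1
  funext i
  exact (hX.identDistrib (e i)).map_eq

omit [MeasurableSpace A] [MeasurableSpace B] in
theorem apply_zero_eq_of_leftRadius_lt {x : ℤ → A} {k : ℕ} (h : leftRadius φ x < k) (y : ℤ → A)
    (hy : ∀ i : ℤ, -(k : ℤ) < i → i ≤ 0 → y i = x i) : φ y 0 = φ x 0 := by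
  obtain ⟨r, hr, hφ⟩ := exists_lt_of_iInf_natCast_lt h
  have hr' : r < k := by exact_mod_cast hr
  exact hφ y fun i hi hi0 => hy i (by omega) hi0

theorem tsum_undetermined_le [IsProbabilityMeasure P] [MeasurableEq B] (hX : IsIID P X)
    (hφ : Measurable φ) (a : A) :
    ∑' k, pastLaw (P.map fun ω => X ω 0)
        (undetermined (P.map fun ω => X ω 0) (fun p => φ (extendFuture a p) 0) k) ≤
      ∫⁻ ω, (2 * (leftRadius φ (X ω) : ℝ≥0∞) + 1) ∂P := by
  have : IsProbabilityMeasure (P.map fun ω => X ω 0) :=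
    Measure.isProbabilityMeasure_map (hX.measurable 0).aemeasurable
  set ψ : (ℕ → A) → B := fun p => φ (extendFuture a p) 0 with hψd
  have hψ : Measurable ψ :=
    (measurable_pi_apply 0).comp (hφ.comp (measurable_extendFuture a))
  set G := undetermined (P.map fun ω => X ω 0) ψ with hG
  have hGm : ∀ k, MeasurableSet (G k) := measurableSet_undetermined hψ
  -- The index is chosen so that the `k` symbols tested are `X_{1-k}, …, X_0`. The event can then be
  -- compared pointwise with `k ≤ r`, without any measurability of the radius.
  let Z : ℕ → Ω → ℕ → A := fun k ω i => X ω ((i : ℤ) - k + 1)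
  have hZm : ∀ k, Measurable (Z k) := fun k => measurable_pi_iff.2 fun i => hX.measurable _
  have hZ : ∀ k, pastLaw (P.map fun ω => X ω 0) (G k) =
      ∫⁻ ω, (Z k ⁻¹' G k).indicator (fun _ => 1) ω ∂P := by
    intro k
    rw [lintegral_indicator_const (hZm k (hGm k)), one_mul, ← Measure.map_apply (hZm k) (hGm k)]
    congr 1
    exact (hX.map_comp_eq (e := fun i : ℕ => (i : ℤ) - k + 1) fun i j h => by
      simpa using h).symm
  simp_rw [hZ]
  rw [← lintegral_tsum fun k => (measurable_const.indicator (hZm k (hGm k))).aemeasurable]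
  refine lintegral_mono fun ω => ?_
  refine le_trans (ENNReal.tsum_le_tsum fun k => ?_)
    (tsum_indicator_natCast_le (leftRadius φ (X ω)))
  split_ifs with hk
  · exact Set.indicator_le_self' (by simp) ω
  · refine (Set.indicator_of_notMem ?_ _).le
    intro hmem
    refine hmem ?_
    have h1 : ∀ q, ψ (extendPast (Z k ω) q k) = φ (X ω) 0 := by
      intro q
      refine apply_zero_eq_of_leftRadius_lt (not_le.1 hk) _ fun i hi hi0 => ?_
      rw [extendFuture, if_pos hi0, extendPast_of_lt _ _ (by omega)]
      simp only [Z]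
      congr 1
      omega
    simp [h1]

/-- A finite left radius makes the filler future irrelevant at site `0`. The resulting equality is a
measurable event, so shift invariance of the law of `X` carries it to every site. -/
theorem ae_coding_eq [IsProbabilityMeasure P] [MeasurableEq B] (hX : IsIID P X)
    (hφ : IsCodingMap φ) (hfin : ∀ᵐ ω ∂P, leftRadius φ (X ω) < ⊤) (a : A) :
    ∀ᵐ ω ∂P, ∀ j : ℤ, φ (X ω) j = φ (extendFuture a fun n : ℕ => X ω (j - n)) 0 := by
  rw [ae_all_iff]
  intro j
  have hm : MeasurableSet {x : ℤ → A | φ x 0 = φ (extendFuture a fun n : ℕ => x (0 - n)) 0} := by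
    refine measurableSet_eq_fun ((measurable_pi_apply 0).comp hφ.measurable) ?_
    exact (measurable_pi_apply 0).comp (hφ.measurable.comp ((measurable_extendFuture a).comp
      (measurable_pi_iff.2 fun n => measurable_pi_apply _)))
  have h0 : ∀ᵐ ω ∂P, X ω ∈ {x | φ x 0 = φ (extendFuture a fun n : ℕ => x (0 - n)) 0} := by
    filter_upwards [hfin] with ω hω
    obtain ⟨r, hr⟩ := ENat.ne_top_iff_exists.1 hω.ne
    refine (apply_zero_eq_of_leftRadius_lt (k := r + 1) ?_ _ fun i hi hi0 => ?_).symm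
    · rw [← hr]; exact_mod_cast Nat.lt_succ_self r
    · rw [extendFuture, if_pos hi0]
      congr 1
      omega
  have hs : ∀ j : ℤ, Measurable fun ω => shift j (X ω) := fun j =>
    measurable_pi_iff.2 fun i => hX.measurable _
  have hlaw : P.map (fun ω => shift j (X ω)) = P.map X :=
    (hX.map_comp_eq (e := fun i : ℤ => i + j) (add_left_injective j)).trans
      (hX.map_comp_eq (e := fun i : ℤ => i) Function.injective_id).symm
  have hXm : Measurable X := measurable_pi_iff.2 hX.measurable
  have hj := (ae_map_iff hXm.aemeasurable hm).2 h0
  rw [← hlaw] at hj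
  have hj' := (ae_map_iff (hs j).aemeasurable hm).1 hj
  filter_upwards [hj'] with ω hω
  simp only [hφ.equivariant] at hω
  simp only [shift, zero_add] at hω
  rw [hω]
  congr 2
  funext n
  congr 1
  omega

omit [MeasurableSpace B] in
theorem integrable_and_log_integral_exp_of_ae_eq [IsProbabilityMeasure P] {f : (ℤ → B) → ℝ} {Y : Ω → ℤ → B}
    {α : Type*} [MeasurableSpace α] {ν : Measure α} [IsProbabilityMeasure ν] {F : α → ℝ}
    (hF : Measurable F) {M : ℝ} (hM : ∀ x, |F x| ≤ M) {Z : Ω → α} (hZ : Measurable Z)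
    (hZν : P.map Z = ν) (hY : ∀ᵐ ω ∂P, f (Y ω) = F (Z ω)) (t : ℝ) :
    Integrable (fun ω => f (Y ω)) P ∧
      Integrable (fun ω => Real.exp (t * (f (Y ω) - ∫ ω', f (Y ω') ∂P))) P ∧
      Real.log (∫ ω, Real.exp (t * (f (Y ω) - ∫ ω', f (Y ω') ∂P)) ∂P) =
        Real.log (∫ x, Real.exp (t * F x) ∂ν) - t * ∫ x, F x ∂ν := by
  have h1 : ∫ ω, f (Y ω) ∂P = ∫ x, F x ∂ν := by
    rw [integral_congr_ae hY, ← hZν, integral_map hZ.aemeasurable hF.aestronglyMeasurable]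
  have hI := integrable_exp_of_bound (ρ := ν) hF hM t
  rw [h1]
  set c := ∫ x, F x ∂ν with hc
  have h2 : (fun ω => Real.exp (t * (f (Y ω) - c))) =ᵐ[P]
      fun ω => Real.exp (t * F (Z ω)) * Real.exp (-(t * c)) := by
    filter_upwards [hY] with ω hω
    rw [hω, ← Real.exp_add]
    ring_nf
  have hIZ : Integrable (fun ω => Real.exp (t * F (Z ω))) P :=
    integrable_exp_of_bound (hF.comp hZ) (fun _ => hM _) t
  refine ⟨(integrable_of_bound (hF.comp hZ) fun _ => hM _).congr (hY.mono fun _ h => h.symm),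
    (hIZ.mul_const _).congr h2.symm, ?_⟩
  have h3 : ∫ ω, Real.exp (t * F (Z ω)) ∂P = ∫ x, Real.exp (t * F x) ∂ν := by
    rw [← hZν, integral_map hZ.aemeasurable (by fun_prop)]
  rw [integral_congr_ae h2, integral_mul_const, h3,
    Real.log_mul (integral_exp_pos hI).ne' (Real.exp_pos _).ne', Real.log_exp]
  ring

theorem IsLeftFinitaryCoding.gaussianBound [IsProbabilityMeasure P] [MeasurableEq B]
    (hX : IsIID P X) {Y : Ω → ℤ → B} (hY : IsLeftFinitaryCoding P X φ Y) :
    GaussianBound P Y (3 * (∫⁻ ω, (2 * (leftRadius φ (X ω) : ℝ≥0∞) + 1) ∂P) ^ 2) := by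
  obtain ⟨ω₀⟩ := nonempty_of_isProbabilityMeasure P
  set a : A := X ω₀ 0
  intro f hfm ⟨s, hs⟩ hf t ht
  set μ := P.map fun ω => X ω 0 with hμ
  have : IsProbabilityMeasure μ :=
    Measure.isProbabilityMeasure_map (hX.measurable 0).aemeasurable
  set ψ : (ℕ → A) → B := fun p => φ (extendFuture a p) 0 with hψd
  have hψ : Measurable ψ :=
    (measurable_pi_apply 0).comp (hY.coding.measurable.comp (measurable_extendFuture a))
  obtain ⟨b, hb⟩ := s.exists_le
  obtain ⟨M, hM⟩ := exists_bound_of_osc_lt_top hf hs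
  have hZm : Measurable fun ω (n : ℕ) => X ω (b - n) :=
    measurable_pi_iff.2 fun n => hX.measurable _
  have hZ : P.map (fun ω (n : ℕ) => X ω (b - n)) = pastLaw μ :=
    hX.map_comp_eq (e := fun n : ℕ => b - (n : ℤ)) fun i j h => by simpa using h
  have hYF : ∀ᵐ ω ∂P, f (Y ω) = pastFunctional f ψ b fun n : ℕ => X ω (b - n) := by
    filter_upwards [hY.eq, ae_coding_eq hX hY.coding hY.finite a] with ω h1 h2
    rw [h1, pastFunctional]
    refine hs fun j hj => ?_
    rw [h2 j]
    simp only [hψd]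
    have := hb j hj
    congr 2
    funext n
    congr 1
    omega
  obtain ⟨hi1, hi2, hlog⟩ := integrable_and_log_integral_exp_of_ae_eq (measurable_pastFunctional hψ hfm b)
    (fun _ => hM _) hZm hZ hYF t
  refine ⟨hi1, hi2, ?_⟩
  rw [hlog]
  set I := ∫⁻ ω, (2 * (leftRadius φ (X ω) : ℝ≥0∞) + 1) ∂P with hI
  have hSI : ∑' k, pastLaw μ (undetermined μ ψ k) ≤ I :=
    tsum_undetermined_le hX hY.coding.measurable a
  set S := ∑' k, pastLaw μ (undetermined μ ψ k) with hS
  suffices h : ∃ v : ℝ, Real.log (∫ x, Real.exp (t * pastFunctional f ψ b x) ∂(pastLaw μ)) -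
      t * ∫ x, pastFunctional f ψ b x ∂(pastLaw μ) ≤ v ∧
      ENNReal.ofReal v ≤ 3 * I ^ 2 * ENNReal.ofReal (t ^ 2) * oscNormSq f by
    obtain ⟨v, hv1, hv2⟩ := h
    refine (EReal.coe_le_coe_iff.2 hv1).trans ?_
    refine le_trans ?_ (EReal.coe_ennreal_le_coe_ennreal_iff.2 hv2)
    rw [EReal.coe_ennreal_ofReal]
    exact EReal.coe_le_coe_iff.2 (le_max_left _ _)
  by_cases hSt : S = ∞
  · have hIt : I = ∞ := top_le_iff.1 (hSt ▸ hSI)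
    -- With an infinite constant, the convention `∞ · 0 = 0` leaves something to prove: zero
    -- oscillations force the functional to be constant, so the left side vanishes.
    by_cases h0 : oscNormSq f = 0
    · have hosc : ∀ j, osc f j = 0 := by
        simpa [oscNormSq, ENNReal.tsum_eq_zero] using h0
      refine ⟨0, ?_, by simp⟩
      have hconst : ∀ x, pastFunctional f ψ b x = pastFunctional f ψ b fun _ => a := by
        intro x
        have := abs_sub_le_sum_osc hf hs (fun j => ψ fun n => x (n + (b - j).toNat))
          (fun j => ψ fun _ => a)
        simp only [hosc, ENNReal.toReal_zero, zero_mul, Finset.sum_const_zero] at this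
        exact sub_eq_zero.1 (abs_nonpos_iff.1 this)
      simp_rw [hconst]
      simp
    · refine ⟨_, le_rfl, ?_⟩
      rw [hIt]
      simp [ENNReal.top_mul, ENNReal.mul_top, h0, ht.ne']
  · refine ⟨t ^ 2 / 2 * (S.toReal ^ 2 * ∑ j ∈ s, (osc f j).toReal ^ 2), ?_, ?_⟩
    · have h1 := integral_exp_pastFunctional_le hψ hfm hf hs (fun j hj => hb j hj) hSt ht
      have h2 := Real.log_le_log (integral_exp_pos (integrable_exp_of_bound
        (measurable_pastFunctional hψ hfm b) (fun _ => hM _) t)) h1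
      rw [Real.log_exp] at h2
      linarith
    · have hD : 0 ≤ ∑ j ∈ s, (osc f j).toReal ^ 2 := Finset.sum_nonneg fun _ _ => sq_nonneg _
      calc ENNReal.ofReal (t ^ 2 / 2 * (S.toReal ^ 2 * ∑ j ∈ s, (osc f j).toReal ^ 2))
          ≤ ENNReal.ofReal (S.toReal ^ 2 * t ^ 2 * ∑ j ∈ s, (osc f j).toReal ^ 2) := by
            refine ENNReal.ofReal_le_ofReal ?_
            have : 0 ≤ t ^ 2 * (S.toReal ^ 2 * ∑ j ∈ s, (osc f j).toReal ^ 2) := by positivity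
            nlinarith
        _ = S ^ 2 * ENNReal.ofReal (t ^ 2) * ∑ j ∈ s, osc f j ^ 2 := by
            rw [ENNReal.ofReal_mul (by positivity), ENNReal.ofReal_mul (by positivity),
              ENNReal.ofReal_pow ENNReal.toReal_nonneg, ENNReal.ofReal_toReal hSt,
              ENNReal.ofReal_sum_of_nonneg fun _ _ => sq_nonneg _]
            congr 1
            refine Finset.sum_congr rfl fun j _ => ?_
            rw [ENNReal.ofReal_pow ENNReal.toReal_nonneg, ENNReal.ofReal_toReal (hf j).ne]
        _ ≤ 3 * I ^ 2 * ENNReal.ofReal (t ^ 2) * oscNormSq f := by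
            have h3 : S ^ 2 ≤ 3 * I ^ 2 :=
              (pow_le_pow_left' hSI 2).trans (le_mul_of_one_le_left' (by norm_num))
            exact mul_le_mul' (mul_le_mul' h3 le_rfl) (ENNReal.sum_le_tsum s)

theorem GaussianBound.mono {Y : Ω → ℤ → B} {C C' : ℝ≥0∞} (h : GaussianBound P Y C) (hC : C ≤ C') :
    GaussianBound P Y C' := by
  intro f hfm hloc hf t ht
  obtain ⟨h1, h2, h3⟩ := h f hfm hloc hf t ht
  refine ⟨h1, h2, h3.trans (EReal.coe_ennreal_le_coe_ennreal_iff.2 ?_)⟩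
  gcongr

end

section

/-! ### Coupling from the past -/

section Recursion

variable {A B : Type*} (f : (ℕ → B) → A → B)

theorem srsPast_add (p : ℕ → B) (m : ℤ) (x : ℤ → A) (k n : ℕ) :
    srsPast f p m x (k + n) = srsPast f (srsPast f p m x k) (m + k) x n := by
  induction n with
  | zero => rfl
  | succ n ih =>
    rw [← add_assoc]
    simp only [srsPast]
    rw [ih]
    congr 3
    push_cast
    ring

theorem srsPast_congr (p : ℕ → B) (m : ℤ) {x y : ℤ → A} {n : ℕ}
    (h : ∀ i : ℕ, i < n → x (m + i) = y (m + i)) : srsPast f p m x n = srsPast f p m y n := by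
  induction n with
  | zero => rfl
  | succ n ih =>
    simp only [srsPast]
    rw [ih fun i hi => h i (by omega), h n (by omega)]

theorem srsState_congr (p : ℕ → B) (m : ℤ) {x y : ℤ → A} {n : ℕ}
    (h : ∀ i : ℕ, i ≤ n → x (m + i) = y (m + i)) : srsState f p m x n = srsState f p m y n := by
  rw [srsState, srsState, srsPast_congr f p m fun i hi => h i hi.le, h n le_rfl]

theorem srsPast_shift (p : ℕ → B) (m i : ℤ) (x : ℤ → A) (n : ℕ) :
    srsPast f p m (shift i x) n = srsPast f p (m + i) x n := by
  induction n with
  | zero => rfl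
  | succ n ih =>
    simp only [srsPast]
    rw [ih]
    simp only [shift]
    congr 3
    ring

theorem srsState_shift (p : ℕ → B) (m i : ℤ) (x : ℤ → A) (n : ℕ) :
    srsState f p m (shift i x) n = srsState f p (m + i) x n := by
  rw [srsState, srsState, srsPast_shift, shift]
  congr 2
  ring

/-- The state at time `0` of the recursion started at time `-k` does not depend on the past. -/
def IsRegenerative (x : ℤ → A) (k : ℕ) : Prop :=
  ∀ p p' : ℕ → B, srsState f p (-(k : ℤ)) x k = srsState f p' (-(k : ℤ)) x k

variable {f}

/-- A recursion started earlier is, from time `-k` on, a recursion started at `-k` from some other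
past. -/
theorem IsRegenerative.srsState_eq_of_le {x : ℤ → A} {k n : ℕ} (h : IsRegenerative f x k)
    (hkn : k ≤ n) (p p' : ℕ → B) :
    srsState f p (-(n : ℤ)) x n = srsState f p' (-(k : ℤ)) x k := by
  obtain ⟨d, rfl⟩ := Nat.exists_eq_add_of_le' hkn
  rw [h p' (srsPast f p (-((d + k : ℕ) : ℤ)) x d), srsState, srsState, srsPast_add]
  have h1 : -((d + k : ℕ) : ℤ) + d = -(k : ℤ) := by push_cast; ring
  rw [h1]
  congr 2
  ring

theorem IsRegenerative.congr {x y : ℤ → A} {k : ℕ} (h : IsRegenerative f x k)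
    (hxy : ∀ i : ℤ, -(k : ℤ) ≤ i → i ≤ 0 → y i = x i) : IsRegenerative f y k := by
  have h1 : ∀ p, srsState f p (-(k : ℤ)) y k = srsState f p (-(k : ℤ)) x k := fun p =>
    srsState_congr f p _ fun i hi => hxy _ (by omega) (by omega)
  intro p p'
  rw [h1, h1]
  exact h p p'

theorem isRegenerative_of_regenTime_eq {x : ℤ → A} {k : ℕ} (h : regenTime f x = k) :
    IsRegenerative f x k := by
  -- A strict comparison with `k + 1` extracts a witness, which minimality then forces to be `k`.
  obtain ⟨r, hr, hp⟩ := exists_lt_of_iInf_natCast_lt (p := IsRegenerative f x)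
    (n := ((k + 1 : ℕ) : ℕ∞)) (by
      change regenTime f x < _
      rw [h]
      exact_mod_cast Nat.lt_succ_self k)
  have h1 : regenTime f x ≤ r := iInf₂_le r hp
  rw [h] at h1
  have h2 : k ≤ r := by exact_mod_cast h1
  have h3 : r < k + 1 := by exact_mod_cast hr
  obtain rfl : r = k := by omega
  exact hp

open Classical in
/-- The common value at time `0` of all recursions started sufficiently far in the past, or `b`
when there is none. -/
noncomputable def limitState (f : (ℕ → B) → A → B) (b : B) (x : ℤ → A) : B :=
  if h : ∃ N : ℕ, ∀ k ≥ N, srsState f (fun _ => b) (-(k : ℤ)) x k =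
      srsState f (fun _ => b) (-(N : ℤ)) x N then
    srsState f (fun _ => b) (-(h.choose : ℤ)) x h.choose
  else b

theorem IsRegenerative.limitState_eq {x : ℤ → A} {k : ℕ} (h : IsRegenerative f x k) (b : B)
    (p : ℕ → B) : limitState f b x = srsState f p (-(k : ℤ)) x k := by
  have hex : ∃ N : ℕ, ∀ k ≥ N, srsState f (fun _ => b) (-(k : ℤ)) x k =
      srsState f (fun _ => b) (-(N : ℤ)) x N :=
    ⟨k, fun n hn => h.srsState_eq_of_le hn _ _⟩
  rw [limitState, dif_pos hex]
  have h1 := hex.choose_spec (max k hex.choose) (le_max_right _ _)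
  rw [← h1]
  exact h.srsState_eq_of_le (le_max_left _ _) _ _

/-- Regeneration from `-k` is itself visible in the coordinates `-k, …, 0`, and so is the common
state it produces. -/
theorem leftRadius_limitState_le (f : (ℕ → B) → A → B) (b : B) (x : ℤ → A) :
    leftRadius (fun x i => limitState f b (shift i x)) x ≤ regenTime f x := by
  refine le_iInf₂ fun k hk => iInf₂_le k fun y hy => ?_
  have hx : IsRegenerative f x k := hk
  have h0 : ∀ x : ℤ → A, shift 0 x = x := fun x => funext fun i => by simp [shift]
  simp only [h0]
  rw [(hx.congr hy).limitState_eq b (fun _ => b), hx.limitState_eq b (fun _ => b)]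
  exact srsState_congr f _ _ fun i hi => hy _ (by omega) (by omega)

variable [MeasurableSpace A] [MeasurableSpace B] (hf : Measurable (Function.uncurry f))

include hf in
theorem measurable_srsPast (p : ℕ → B) (m : ℤ) (n : ℕ) :
    Measurable fun x : ℤ → A => srsPast f p m x n := by
  induction n with
  | zero => exact measurable_const
  | succ n ih =>
    exact measurable_push.comp (ih.prodMk (hf.comp (ih.prodMk (measurable_pi_apply _))))

include hf in
theorem measurable_srsState (p : ℕ → B) (m : ℤ) (n : ℕ) :
    Measurable fun x : ℤ → A => srsState f p m x n :=
  hf.comp ((measurable_srsPast hf p m n).prodMk (measurable_pi_apply _))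

-- Where the states stabilise, the limit lies in `T` exactly when they eventually do, so only
-- countable set operations occur. Avoiding `regenTime` in `limitState` avoids quantifying over all
-- pasts.
include hf in
theorem measurable_limitState [MeasurableEq B] (b : B) : Measurable (limitState f b) := by
  classical
  set g : ℕ → (ℤ → A) → B := fun k x => srsState f (fun _ => b) (-(k : ℤ)) x k with hg
  have hgm : ∀ k, Measurable (g k) := fun k => measurable_srsState hf _ _ _
  have hC : MeasurableSet {x | ∃ N, ∀ k ≥ N, g k x = g N x} := by
    simp only [Set.ofPred_exists, Set.ofPred_forall]
    exact .iUnion fun N => .iInter fun k => .iInter fun _ => measurableSet_eq_fun (hgm k) (hgm N)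
  intro T hT
  have hE : MeasurableSet {x | ∃ N, ∀ k ≥ N, g k x ∈ T} := by
    simp only [Set.ofPred_exists, Set.ofPred_forall]
    exact .iUnion fun N => .iInter fun k => .iInter fun _ => hgm k hT
  have h1 : limitState f b ⁻¹' T = {x | ∃ N, ∀ k ≥ N, g k x = g N x}.ite
      {x | ∃ N, ∀ k ≥ N, g k x ∈ T} ((fun _ => b) ⁻¹' T) := by
    ext x
    by_cases hx : ∃ N, ∀ k ≥ N, g k x = g N x
    · have h2 : limitState f b x = g hx.choose x := dif_pos hx
      have h3 : (∃ N, ∀ k ≥ N, g k x ∈ T) ↔ g hx.choose x ∈ T := by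
        constructor
        · rintro ⟨N, hN⟩
          rw [← hx.choose_spec (max N hx.choose) (le_max_right _ _)]
          exact hN _ (le_max_left _ _)
        · intro h
          refine ⟨hx.choose, fun k hk => ?_⟩
          rwa [hx.choose_spec k hk]
      simp only [Set.mem_preimage, h2, Set.ite, Set.mem_union, Set.mem_inter_iff, Set.mem_sdiff,
        Set.mem_ofPred_eq, h3]
      tauto
    · have h2 : limitState f b x = b := dif_neg hx
      simp only [Set.mem_preimage, h2, Set.ite, Set.mem_union, Set.mem_inter_iff, Set.mem_sdiff,
        Set.mem_ofPred_eq]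
      tauto
  rw [h1]
  exact hC.ite hE (measurable_const hT)

include hf in
theorem isCodingMap_limitState [MeasurableEq B] (b : B) :
    IsCodingMap fun (x : ℤ → A) i => limitState f b (shift i x) where
  measurable := measurable_pi_iff.2 fun i => (measurable_limitState hf b).comp
    (measurable_pi_iff.2 fun _ => measurable_pi_apply _)
  equivariant j x := by
    funext i
    have h : shift i (shift j x) = shift (i + j) x := funext fun l => by
      simp only [shift]
      congr 1
      ring
    rw [h]
    rfl

end Recursion

/-! ### Outputs of coupling from the past as codings, and solutions of the recursion -/

variable {Ω A B : Type*} [MeasurableSpace Ω] {P : Measure Ω} {X : Ω → ℤ → A}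
  {f : (ℕ → B) → A → B} {Y : Ω → ℤ → B}

theorem IsCFTPOutput.isLeftFinitaryCoding [MeasurableSpace A] [MeasurableSpace B] [MeasurableEq B]
    (hf : Measurable (Function.uncurry f)) (hY : IsCFTPOutput P X f Y) (b : B) :
    IsLeftFinitaryCoding P X (fun x i => limitState f b (shift i x)) Y where
  coding := isCodingMap_limitState hf b
  eq := by
    filter_upwards [hY] with ω hω
    funext i
    obtain ⟨k, hk, h⟩ := hω i
    rw [h fun _ => b, (isRegenerative_of_regenTime_eq hk).limitState_eq b fun _ => b,
      srsState_shift]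
    congr 1
    ring
  finite := by
    filter_upwards [hY] with ω hω
    obtain ⟨k, hk, -⟩ := hω 0
    have h0 : shift 0 (X ω) = X ω := funext fun i => by simp [shift]
    rw [h0] at hk
    refine (leftRadius_limitState_le f b (X ω)).trans_lt ?_
    rw [hk]
    exact ENat.natCast_lt_top k

theorem srsPast_eq_of_recursive {x : ℤ → A} {y : ℤ → B}
    (h : ∀ i : ℤ, y i = f (fun n : ℕ => y (i - 1 - (n : ℤ))) (x i)) (m : ℤ) (n : ℕ) :
    srsPast f (fun l : ℕ => y (m - 1 - l)) m x n = fun l : ℕ => y (m + n - 1 - l) := by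
  induction n with
  | zero => simp [srsPast]
  | succ n ih =>
    simp only [srsPast]
    rw [ih, ← h (m + n)]
    funext l
    cases l with
    | zero => simp only [push]; congr 1; push_cast; ring
    | succ l => simp only [push]; congr 1; push_cast; ring

theorem IsRecursiveSequence.isCFTPOutput
    (hθ : ∀ᵐ ω ∂P, ∀ i : ℤ, regenTime f (shift i (X ω)) < ⊤)
    (hY : IsRecursiveSequence P X f Y) : IsCFTPOutput P X f Y := by
  filter_upwards [hθ, hY] with ω hω hrec i
  obtain ⟨k, hk⟩ := ENat.ne_top_iff_exists.1 (hω i).ne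
  refine ⟨k, hk.symm, fun p => ?_⟩
  -- The arbitrary past may be exchanged for the past of `Y` itself, from which the recursion
  -- reproduces `Y`.
  have h1 := isRegenerative_of_regenTime_eq hk.symm p fun l : ℕ => Y ω (i - k - 1 - l)
  have hki : -(k : ℤ) + i = i - k := by ring
  rw [srsState_shift, srsState_shift, hki] at h1
  rw [h1, srsState, srsPast_eq_of_recursive hrec]
  simpa using hrec i

end

end LeftFinitary

theorem mainTheorem11
    {Ω A B : Type*} [MeasurableSpace Ω]
    [MeasurableSpace A] [StandardBorelSpace A] [MeasurableSpace B] [StandardBorelSpace B]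
    (P : Measure Ω) [IsProbabilityMeasure P] (X : Ω → ℤ → A) (hX : IsIID P X) :
    -- left finitary codings
    (∀ (φ : (ℤ → A) → (ℤ → B)) (Y : Ω → ℤ → B), IsLeftFinitaryCoding P X φ Y →
      GaussianBound P Y (3 * (∫⁻ ω, (2 * (leftRadius φ (X ω) : ℝ≥0∞) + 1) ∂P) ^ 2)) ∧
    -- outputs of coupling-from-the-past algorithms
    (∀ f : (ℕ → B) → A → B, Measurable (Function.uncurry f) → ∀ Y : Ω → ℤ → B,
      IsCFTPOutput P X f Y → ∫⁻ ω, (regenTime f (X ω) : ℝ≥0∞) ∂P < ∞ →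
      3 * (∫⁻ ω, (2 * (regenTime f (X ω) : ℝ≥0∞) + 1) ∂P) ^ 2 < ∞ ∧
      GaussianBound P Y (3 * (∫⁻ ω, (2 * (regenTime f (X ω) : ℝ≥0∞) + 1) ∂P) ^ 2)) ∧
    -- such an output is what the recursion itself produces
    (∀ f : (ℕ → B) → A → B, Measurable (Function.uncurry f) → ∀ Y : Ω → ℤ → B,
      (∀ᵐ ω ∂P, ∀ i : ℤ, regenTime f (shift i (X ω)) < ⊤) →
      IsRecursiveSequence P X f Y → IsCFTPOutput P X f Y) := by
  refine ⟨fun φ Y hY => hY.gaussianBound hX, fun f hf Y hY hθ => ⟨?_, ?_⟩,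
    fun f _ Y hθ hY => hY.isCFTPOutput hθ⟩
  -- Linearity is used only for a measurable constant summand and a finite factor, so `regenTime`
  -- need not be measurable.
  · rw [lintegral_add_right _ measurable_const, lintegral_const_mul' _ _ (by simp)]
    refine ENNReal.mul_lt_top (by simp) (ENNReal.pow_lt_top ?_)
    exact ENNReal.add_lt_top.2 ⟨ENNReal.mul_lt_top (by simp) hθ, by simp⟩
  · obtain ⟨ω₀⟩ := nonempty_of_isProbabilityMeasure P
    refine ((hY.isLeftFinitaryCoding hf (Y ω₀ 0)).gaussianBound hX).mono ?_
    gcongr with ω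
    exact leftRadius_limitState_le f (Y ω₀ 0) (X ω)
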